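/- A \emph{multiplicative lattice} is a complete lattice $Q$ with least element $0$ and greatest element $1\neq 0$, with an associative, commutative multiplication that distributes over arbitrary joins and has $1$ as identity. Write $(a:b)=\bigvee\{x\in Q: xb\le a\}$. An element $e\in Q$ is \emph{principal} if $a\wedge be=((a:e)\wedge b)e$ and $a\vee(b:e)=((ae\vee b):e)$ for all $a,b\in Q$; an element $p<1$ is \emph{prime} if $xy\le p$ implies $x\le p$ or $y\le p$; an element $a$ is \emph{completely strongly hollow} if, for every nonempty family $(i_\lambda)_\lambda$ in $Q$, $a\le\bigvee_\lambda i_\lambda$ implies $a\le i_\lambda$ for some $\lambda$. $Q$ is a \emph{weak $r$-lattice} if $1$ is compact, products of compact elements are compact, every element is a join of compact elements, and every element is a join of principal elements. A \emph{weak Noether lattice} is a weak $r$-lattice satisfying the ascending chain condition; a \emph{chain lattice} is one whose order is total. A \emph{UFD lattice} is a multiplicative lattice in which every element is a join of principal elements, $0$ is prime, and every principal element is a finite (possibly empty) product of principal primes. A \emph{special principal element lattice} is a multiplicative lattice in which every element is principal and which has a unique maximal element (element maximal among those $<1$) such that every element is a join of powers of it. $B_4$ denotes the four-element Boolean algebra,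 with meet as multiplication. \textbf{Theorem.} Let $Q$ be a weak $r$-lattice. The following are equivalent: \begin{enumerate} \item every nonzero prime element of $Q$ is completely strongly hollow; \item $Q$ is either (isomorphic to) $B_4$ or a weak Noether chain lattice which is a UFD lattice or a special principal element lattice; \item every nonzero element $a\neq 1$ of $Q$ is completely strongly hollow; \item every nonzero element $a\neq 1$ of $Q$ is a finite product of completely strongly hollow elements. \end{enumerate} Moreover, the following, in which the element $1$ is included and $B_4$ does not occur, are equivalent: \begin{enumerate} \item[(3$'$)] every nonzero element of $Q$ is completely strongly hollow; \item[(4$'$)] every nonzero element of $Q$ is a finite nonempty product of completely strongly hollow elements; \item[(2$'$)] $Q$ is a weak Noether chain lattice which is a UFD lattice or a special principal element lattice. \end{enumerate} -/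

import Mathlib

/-- A multiplicative lattice: a complete lattice with a commutative associative multiplication that
distributes over arbitrary joins (the condition `IsQuantale`) and whose identity `1` is the top
element.  The least element, written `0` in the mathematical text, is `⊥`. -/
class IsMultiplicativeLattice (Q : Type*) [CommMonoid Q] [CompleteLattice Q] : Prop
    extends IsQuantale Q where
  one_eq_top : (1 : Q) = ⊤

namespace MultLattice

section Elements

variable {Q : Type*} [CommMonoid Q] [CompleteLattice Q]

/-- The residual `(a : b)`. -/
def residual (a b : Q) : Q := sSup {x | x * b ≤ a}

/-- Principal elements: meet-principal and join-principal. -/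
structure IsPrincipal (e : Q) : Prop where
  meet : ∀ a b : Q, a ⊓ b * e = (residual a e ⊓ b) * e
  join : ∀ a b : Q, a ⊔ residual b e = residual (a * e ⊔ b) e

/-- Prime elements (of the multiplicative lattice). -/
structure IsPrimeElement (p : Q) : Prop where
  lt_one : p < 1
  le_or_le : ∀ x y : Q, x * y ≤ p → x ≤ p ∨ y ≤ p

/-- Completely strongly hollow elements.  A (nonempty) family is replaced by its set of values. -/
def IsCompletelyStronglyHollow (a : Q) : Prop :=
  ∀ S : Set Q, S.Nonempty → a ≤ sSup S → ∃ i ∈ S, a ≤ i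

end Elements

section Lattices

variable (Q : Type*) [CommMonoid Q] [CompleteLattice Q]

/-- Every element is a join of principal elements. -/
def IsPrincipallyGenerated : Prop :=
  ∀ x : Q, ∃ S : Set Q, (∀ s ∈ S, IsPrincipal s) ∧ sSup S = x

/-- `C`-lattices. -/
structure IsCLattice : Prop where
  one_compact : IsCompactElement (1 : Q)
  mul_compact : ∀ x y : Q, IsCompactElement x → IsCompactElement y → IsCompactElement (x * y)
  compactly_generated : ∀ x : Q, ∃ S : Set Q, (∀ s ∈ S, IsCompactElement s) ∧ sSup S = x

/-- Weak `r`-lattices. -/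
structure IsWeakRLattice : Prop where
  cLattice : IsCLattice Q
  principally_generated : IsPrincipallyGenerated Q

/-- Weak Noether lattices: weak `r`-lattices with the ascending chain condition. -/
structure IsWeakNoetherLattice : Prop where
  weakRLattice : IsWeakRLattice Q
  acc : WellFoundedGT Q

/-- The order is total. -/
def IsChainLattice : Prop := ∀ a b : Q, a ≤ b ∨ b ≤ a

/-- Principal element lattices: every element is principal. -/
def IsPrincipalElementLattice : Prop := ∀ x : Q, IsPrincipal x

/-- UFD lattices: principally generated domains (that is, `0` is prime) in which every principal
element is a finite product of principal primes; the empty product is `1`. -/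
structure IsUFDLattice : Prop where
  principally_generated : IsPrincipallyGenerated Q
  domain : IsPrimeElement (⊥ : Q)
  factorization : ∀ x : Q, IsPrincipal x →
    ∃ s : Multiset Q, (∀ p ∈ s, IsPrincipal p ∧ IsPrimeElement p) ∧ s.prod = x

/-- Special principal element lattices: principal element lattices with a unique maximal element
`m` such that every element is a join of powers of `m`. -/
structure IsSpecialPrincipalElementLattice : Prop where
  principal : IsPrincipalElementLattice Q
  powers_generate : ∃ m : Q, IsCoatom m ∧ (∀ n : Q, IsCoatom n → n = m) ∧
    ∀ x : Q, ∃ S : Set ℕ, (⨆ n ∈ S, m ^ n) = x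

/-- `Q` is isomorphic, as a multiplicative lattice, to the four-element Boolean algebra with meet
as multiplication. -/
def IsBooleanAlgebraB4 : Prop :=
  ∃ e : Q ≃o Bool × Bool, ∀ x y : Q, e (x * y) = e x ⊓ e y

end Lattices

end MultLattice

/-! A hollow element belongs to any family of principal elements joining to it, so it is principal;
hence (1) makes all primes principal. Maximal elements are prime. With two of them, each lies below
whatever the other does not dominate, which leaves only `B₄`. With a single one `m`, every element
is `⊥` or a power of `m`: the meet of the powers is zero by a Nakayama argument. Such a lattice is a
chain with ACC, special if `m` is nilpotent and a UFD lattice otherwise. Conversely, in a chain with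
ACC the join of a nonempty family is attained, so everything is hollow. From (4) to (1): a prime
that is a product equals one of its factors. The primed statements exclude `B₄` because its `1` is a
join of two atoms. -/

namespace MultLattice

section Chain

variable {Q : Type*} [CompleteLattice Q]

theorem IsCompletelyStronglyHollow.le_or_le {a x y : Q} (ha : IsCompletelyStronglyHollow a)
    (h : a ≤ x ⊔ y) : a ≤ x ∨ a ≤ y := by
  obtain ⟨i, hi, hai⟩ := ha {x, y} ⟨x, by simp⟩ (by simpa using h)
  rcases hi with rfl | rfl
  · exact Or.inl hai
  · exact Or.inr hai

theorem IsChainLattice.isCompletelyStronglyHollow [WellFoundedGT Q] (h : IsChainLattice Q)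
    (a : Q) : IsCompletelyStronglyHollow a := by
  intro S hS ha
  obtain ⟨i, hi, hmax⟩ := wellFounded_gt.has_min S hS
  refine ⟨i, hi, ha.trans (sSup_le fun x hx => ?_)⟩
  rcases h x i with hxi | hix
  · exact hxi
  · by_contra hne
    exact hmax x hx (lt_of_le_not_ge hix hne)

end Chain

theorem IsPrimeElement.exists_mem_le {Q : Type*} [CommMonoid Q] [CompleteLattice Q] {p : Q}
    (hp : IsPrimeElement p) {s : Multiset Q} (h : s.prod ≤ p) : ∃ b ∈ s, b ≤ p := by
  induction s using Multiset.induction_on with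
  | empty => exact absurd (by simpa using h) hp.lt_one.not_ge
  | cons a s ih =>
    rw [Multiset.prod_cons] at h
    rcases hp.le_or_le _ _ h with h | h
    · exact ⟨a, by simp, h⟩
    · obtain ⟨b, hb, hbp⟩ := ih h
      exact ⟨b, by simp [hb], hbp⟩

/-! ### Residuals and principal elements -/

variable {Q : Type*} [CommMonoid Q] [CompleteLattice Q] [IsMultiplicativeLattice Q]

theorem le_one' (a : Q) : a ≤ 1 := IsMultiplicativeLattice.one_eq_top (Q := Q) ▸ le_top

theorem mul_le_right' (a b : Q) : a * b ≤ b :=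
  (mul_le_mul_left (le_one' a) b).trans_eq (one_mul b)

theorem mul_le_left' (a b : Q) : a * b ≤ a :=
  (mul_le_mul_right (le_one' b) a).trans_eq (mul_one a)

theorem le_residual_iff {x a b : Q} : x ≤ residual a b ↔ x * b ≤ a :=
  Quantale.leftMulResiduation_le_iff_mul_le (x := x) (y := b) (z := a)

theorem residual_residual (a b c : Q) : residual (residual a b) c = residual a (c * b) :=
  eq_of_forall_le_iff fun x => by simp only [le_residual_iff, mul_assoc]

theorem residual_mul_le (a b : Q) : residual a b * b ≤ a := le_residual_iff.1 le_rfl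

theorem isPrincipal_one : IsPrincipal (1 : Q) := by
  have h (a : Q) : residual a 1 = a :=
    eq_of_forall_le_iff fun x => by simp only [le_residual_iff, mul_one]
  constructor <;> intro a b <;> simp only [h, mul_one]

theorem isPrincipal_bot : IsPrincipal (⊥ : Q) := by
  have h (a : Q) : residual a ⊥ = ⊤ := top_le_iff.1 (le_residual_iff.2 (by simp))
  constructor <;> intro a b <;> simp [h]

theorem IsPrincipal.mul {e f : Q} (he : IsPrincipal e) (hf : IsPrincipal f) :
    IsPrincipal (e * f) := by
  constructor <;> intro a b
  · rw [← mul_assoc, hf.meet, he.meet, residual_residual, mul_assoc]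
  · rw [← residual_residual b f e, he.join, hf.join, residual_residual, mul_assoc]

theorem IsPrincipal.pow {e : Q} (he : IsPrincipal e) (n : ℕ) : IsPrincipal (e ^ n) := by
  induction n with
  | zero => simpa using isPrincipal_one
  | succ n ih => simpa [pow_succ] using ih.mul he

theorem IsPrincipal.residual_mul_eq {e x : Q} (he : IsPrincipal e) (h : x ≤ e) :
    residual x e * e = x := by
  have := he.meet x 1
  rwa [one_mul, inf_eq_left.2 h, inf_eq_left.2 (le_one' _), eq_comm] at this

/-- Nakayama in lattice form: join-principality rewrites the left side as `(je : e)`, which contains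
`1`. -/
theorem IsPrincipal.sup_residual_bot_eq_one {e j : Q} (he : IsPrincipal e) (h : e ≤ j * e) :
    j ⊔ residual ⊥ e = 1 := by
  rw [he.join]
  exact le_antisymm (le_one' _) (le_residual_iff.2 (by simpa using h))

theorem eq_bot_of_residual_bot_eq_one {e : Q} (h : residual ⊥ e = 1) : e = ⊥ := by
  simpa [h] using residual_mul_le ⊥ e

theorem prod_le_of_mem {s : Multiset Q} {b : Q} (hb : b ∈ s) : s.prod ≤ b := by
  obtain ⟨t, rfl⟩ := Multiset.exists_cons_of_mem hb
  simpa using mul_le_left' b t.prod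

/-! ### Maximal elements, and the case of two of them -/

theorem isCoatom_iff_one {m : Q} : IsCoatom m ↔ m ≠ 1 ∧ ∀ x, m < x → x = 1 := by
  rw [IsCoatom, IsMultiplicativeLattice.one_eq_top]

theorem sup_eq_one_of_isCoatom {m x : Q} (hm : IsCoatom m) (h : ¬ x ≤ m) : m ⊔ x = 1 :=
  (isCoatom_iff_one.1 hm).2 _ (left_lt_sup.2 h)

theorem isPrimeElement_of_isCoatom {m : Q} (hm : IsCoatom m) : IsPrimeElement m where
  lt_one := lt_of_le_of_ne (le_one' m) (isCoatom_iff_one.1 hm).1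
  le_or_le x y h := by
    by_contra! hc
    have : (1 : Q) ≤ m := by
      calc (1 : Q) = (m ⊔ x) * (m ⊔ y) := by
            rw [sup_eq_one_of_isCoatom hm hc.1, sup_eq_one_of_isCoatom hm hc.2, one_mul]
        _ ≤ m := by
            rw [Quantale.sup_mul_distrib, Quantale.mul_sup_distrib (x := x)]
            exact sup_le (mul_le_left' _ _) (sup_le (mul_le_right' _ _) h)
    exact (isCoatom_iff_one.1 hm).1 (le_antisymm (le_one' m) this)

theorem IsCompletelyStronglyHollow.isPrincipal (hg : IsPrincipallyGenerated Q) {a : Q}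
    (ha : IsCompletelyStronglyHollow a) : IsPrincipal a := by
  obtain ⟨S, hS, rfl⟩ := hg a
  rcases S.eq_empty_or_nonempty with rfl | hne
  · simpa using isPrincipal_bot
  · obtain ⟨i, hi, hle⟩ := ha S hne le_rfl
    rw [le_antisymm hle (le_sSup hi)]
    exact hS i hi

/-- A completely strongly hollow maximal element lies below everything that does not lie below
another maximal element. -/
theorem IsCompletelyStronglyHollow.le_of_not_le {m n x : Q} (hm : IsCompletelyStronglyHollow m)
    (hn : IsCoatom n) (hmn : ¬ m ≤ n) (hx : ¬ x ≤ n) : m ≤ x :=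
  (hm.le_or_le ((le_one' m).trans_eq (sup_eq_one_of_isCoatom hn hx).symm)).resolve_left hmn

/-- An idempotent principal element acts as an identity on the elements below it. -/
theorem IsPrincipal.mul_eq_of_idempotent {m a : Q} (hm : IsPrincipal m) (hmm : m * m = m)
    (ha : a ≤ m) : a * m = a := by
  conv_lhs => rw [← hm.residual_mul_eq ha, mul_assoc, hmm]
  exact hm.residual_mul_eq ha

/-- Four elements `⊥`, `m`, `n`, `1`, with `m` and `n` idempotent and incomparable, form `B₄`. -/
theorem isBooleanAlgebraB4_of_classification {m n : Q} (hmm : m * m = m) (hnn : n * n = n)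
    (hmn : ¬ m ≤ n) (hnm : ¬ n ≤ m) (hsup : m ⊔ n = 1)
    (hcl : ∀ x : Q, x = ⊥ ∨ x = m ∨ x = n ∨ x = 1) : IsBooleanAlgebraB4 Q := by
  classical
  have hm0 : ¬ m ≤ ⊥ := fun h => hmn (h.trans bot_le)
  have hn0 : ¬ n ≤ ⊥ := fun h => hnm (h.trans bot_le)
  -- The order is detected by which of `m`, `n` lie below an element; idempotence turns products
  -- into meets under this test.
  have key (x y : Q) (h1 : m ≤ x → m ≤ y) (h2 : n ≤ x → n ≤ y) : x ≤ y := by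
    rcases hcl x with rfl | rfl | rfl | rfl
    · exact bot_le
    · exact h1 le_rfl
    · exact h2 le_rfl
    · rw [← hsup]
      exact sup_le (h1 (le_one' _)) (h2 (le_one' _))
  have hmul (p x y : Q) (hp : p * p = p) : p ≤ x * y ↔ p ≤ x ∧ p ≤ y :=
    ⟨fun h => ⟨h.trans (mul_le_left' _ _), h.trans (mul_le_right' _ _)⟩,
      fun h => hp.symm.le.trans (mul_le_mul' h.1 h.2)⟩
  let f : Q ↪o Bool × Bool := OrderEmbedding.ofMapLEIff
    (fun x => (decide (m ≤ x), decide (n ≤ x))) fun x y => by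
      simp only [Prod.mk_le_mk, Bool.le_iff_imp, decide_eq_true_eq]
      exact ⟨fun h => key x y h.1 h.2, fun h => ⟨fun h' => h'.trans h, fun h' => h'.trans h⟩⟩
  have hf (x : Q) : f x = (decide (m ≤ x), decide (n ≤ x)) := rfl
  have hsurj : Function.Surjective f := by
    rintro ⟨_ | _, _ | _⟩
    · exact ⟨⊥, by simp [hf, hm0, hn0, -le_bot_iff]⟩
    · exact ⟨n, by simp [hf, hmn]⟩
    · exact ⟨m, by simp [hf, hnm]⟩
    · exact ⟨1, by simp [hf, le_one']⟩
  refine ⟨RelIso.ofSurjective f hsurj, fun x y => ?_⟩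
  change f (x * y) = f x ⊓ f y
  simp [hf, hmul _ x y hmm, hmul _ x y hnn]

/-- Two distinct completely strongly hollow maximal elements force `B₄`. -/
theorem isBooleanAlgebraB4_of_two_coatoms (hg : IsPrincipallyGenerated Q) {m n : Q}
    (hm : IsCoatom m) (hn : IsCoatom n) (hne : m ≠ n) (hm' : IsCompletelyStronglyHollow m)
    (hn' : IsCompletelyStronglyHollow n) : IsBooleanAlgebraB4 Q := by
  have hmn : ¬ m ≤ n := fun h => hne (((hm.le_iff.1 h).resolve_left hn.1).symm)
  have hnm : ¬ n ≤ m := fun h => hne ((hn.le_iff.1 h).resolve_left hm.1)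
  -- Since `q` is prime, `p * p` is not below `q`, so it dominates `p`.
  have hidem {p q : Q} (hp' : IsCompletelyStronglyHollow p) (hq : IsCoatom q) (hpq : ¬ p ≤ q) :
      p * p = p :=
    le_antisymm (mul_le_left' _ _) (hp'.le_of_not_le hq hpq fun h =>
      ((isPrimeElement_of_isCoatom hq).le_or_le _ _ h).elim hpq hpq)
  have hmm := hidem hm' hn hmn
  have hnn := hidem hn' hm hnm
  have habove {p x : Q} (hp : IsCoatom p) (h : p ≤ x) : x = 1 ∨ x = p := by
    rw [IsMultiplicativeLattice.one_eq_top]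
    exact hp.le_iff.1 h
  -- Both `m` and `n` fix `a`, so Nakayama gives `(m ⊓ n) ⊔ (0 : a) = 1`. Then `(0 : a)` is below
  -- neither `m` nor `n`, which forces it to be `1`.
  have hbot (a : Q) (ha : IsPrincipal a) (hle : a ≤ m ⊓ n) : a = ⊥ := by
    have hle' : a ≤ (m ⊓ n) * a := by
      calc a = a * m * n := by
            rw [(hm'.isPrincipal hg).mul_eq_of_idempotent hmm (hle.trans inf_le_left),
              (hn'.isPrincipal hg).mul_eq_of_idempotent hnn (hle.trans inf_le_right)]
        _ = (m * n) * a := by rw [mul_assoc, mul_comm]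
        _ ≤ (m ⊓ n) * a := mul_le_mul_left (le_inf (mul_le_left' _ _) (mul_le_right' _ _)) a
    have h1 := ha.sup_residual_bot_eq_one hle'
    apply eq_bot_of_residual_bot_eq_one
    by_cases h : residual ⊥ a ≤ n
    · exact absurd ((h1.symm.le).trans (sup_le inf_le_right h))
        (isPrimeElement_of_isCoatom hn).lt_one.not_ge
    · rcases habove hm (hm'.le_of_not_le hn hmn h) with h | h
      · exact h
      · exact absurd ((h1.symm.le).trans (sup_le inf_le_left h.le))
          (isPrimeElement_of_isCoatom hm).lt_one.not_ge
  refine isBooleanAlgebraB4_of_classification hmm hnn hmn hnm (sup_eq_one_of_isCoatom hm hnm)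
    fun x => ?_
  by_cases h1 : x ≤ n
  · by_cases h2 : x ≤ m
    · left
      obtain ⟨S, hS, rfl⟩ := hg x
      exact sSup_eq_bot.2 fun s hs => hbot s (hS s hs)
        (le_inf ((le_sSup hs).trans h2) ((le_sSup hs).trans h1))
    · have := habove hn (hn'.le_of_not_le hm hnm h2)
      tauto
  · have := habove hm (hm'.le_of_not_le hn hmn h1)
    tauto

/-! ### One maximal element: powers of `m` -/

section Local

variable {m : Q}

/-- At the last power `m ^ j` above `x`, write `x = r * m ^ j`. If `r ≠ 1`, then `r ≤ m` and `x ≤ m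
^ (j + 1)`, a contradiction. -/
theorem eq_pow_of_not_le_pow (hm : IsPrincipal m) (hloc : ∀ x : Q, x ≠ 1 → x ≤ m) {x : Q} {k : ℕ}
    (hx : ¬ x ≤ m ^ k) : ∃ j < k, x = m ^ j := by
  induction k with
  | zero => exact absurd (by simpa using le_one' x) hx
  | succ k ih =>
    by_cases h : x ≤ m ^ k
    · refine ⟨k, k.lt_succ_self, ?_⟩
      have hr := (hm.pow k).residual_mul_eq h
      by_cases h1 : residual x (m ^ k) = 1
      · rw [← hr, h1, one_mul]
      · refine absurd ?_ hx
        rw [← hr, pow_succ']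
        exact mul_le_mul_left (hloc _ h1) _
    · obtain ⟨j, hj, rfl⟩ := ih h
      exact ⟨j, hj.trans k.lt_succ_self, rfl⟩

theorem eq_bot_of_le_mul (hloc : ∀ x : Q, x ≠ 1 → x ≤ m) (hm1 : m ≠ 1) {e : Q}
    (he : IsPrincipal e) (h : e ≤ m * e) : e = ⊥ := by
  apply eq_bot_of_residual_bot_eq_one
  by_contra h1
  exact hm1 ((sup_eq_left.2 (hloc _ h1)).symm.trans (he.sup_residual_bot_eq_one h))

/-- Elements outside the meet are powers of `m`. If the product `m ^ (i + j)` were inside, it would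
lie below `m * m ^ (i + j)` and vanish by Nakayama. -/
theorem isPrimeElement_iInf_pow (hm : IsPrincipal m) (hloc : ∀ x : Q, x ≠ 1 → x ≤ m)
    (hm1 : m ≠ 1) (hne : ∀ k, m ^ k ≠ ⊥) : IsPrimeElement (⨅ k, m ^ k) where
  lt_one := ((iInf_le (fun k => m ^ k) 1).trans_eq (pow_one m)).trans_lt
    (lt_of_le_of_ne (le_one' m) hm1)
  le_or_le x y h := by
    by_contra! hc
    simp only [le_iInf_iff, not_forall] at hc
    obtain ⟨⟨k, hk⟩, l, hl⟩ := hc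
    obtain ⟨i, -, rfl⟩ := eq_pow_of_not_le_pow hm hloc hk
    obtain ⟨j, -, rfl⟩ := eq_pow_of_not_le_pow hm hloc hl
    refine hne (i + j) (eq_bot_of_le_mul hloc hm1 (hm.pow _) ?_)
    rw [← pow_succ', pow_add]
    exact (h.trans (iInf_le _ (i + j + 1))).trans_eq (by rw [pow_succ, pow_add])

theorem iInf_pow_eq_bot (hm : IsPrincipal m) (hloc : ∀ x : Q, x ≠ 1 → x ≤ m)
    (hm1 : m ≠ 1) (hP : ∀ p : Q, IsPrimeElement p → IsPrincipal p) : ⨅ k, m ^ k = ⊥ := by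
  by_cases hne : ∃ k, m ^ k = ⊥
  · obtain ⟨k, hk⟩ := hne
    exact le_bot_iff.1 ((iInf_le _ k).trans_eq hk)
  push Not at hne
  have hq := isPrimeElement_iInf_pow hm hloc hm1 hne
  set q := ⨅ k, m ^ k with hqdef
  have hqm : q ≤ m := (iInf_le (fun k => m ^ k) 1).trans_eq (pow_one m)
  apply eq_bot_of_le_mul hloc hm1 (hP q hq)
  have hr := hm.residual_mul_eq hqm
  -- Here `q = (q : m) * m` with `q` prime. Either `(q : m) ≤ q`, so `q ≤ m * q`, or `m ≤ q ≤ m ^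
  -- 2`, which kills `m`.
  rcases hq.le_or_le _ _ hr.le with h | h
  · exact hr.symm.le.trans ((mul_le_mul_left h m).trans_eq (mul_comm _ _))
  · have hmq : m = q := le_antisymm h hqm
    have : m = ⊥ := eq_bot_of_le_mul hloc hm1 hm (by
      rw [← sq]
      exact h.trans (iInf_le _ 2))
    exact absurd ((pow_one m).trans this) (hne 1)

theorem eq_bot_or_eq_pow (hm : IsPrincipal m) (hloc : ∀ x : Q, x ≠ 1 → x ≤ m)
    (hm1 : m ≠ 1) (hP : ∀ p : Q, IsPrimeElement p → IsPrincipal p) (x : Q) :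
    x = ⊥ ∨ ∃ k, x = m ^ k := by
  by_cases h : ∃ k, ¬ x ≤ m ^ k
  · obtain ⟨k, hk⟩ := h
    obtain ⟨j, -, hj⟩ := eq_pow_of_not_le_pow hm hloc hk
    exact Or.inr ⟨j, hj⟩
  · push Not at h
    exact Or.inl (le_bot_iff.1 ((le_iInf h).trans_eq (iInf_pow_eq_bot hm hloc hm1 hP)))

theorem chain_of_powers (hcl : ∀ x : Q, x = ⊥ ∨ ∃ k, x = m ^ k) :
    IsChainLattice Q ∧ WellFoundedGT Q := by
  have hanti {i j : ℕ} (h : i ≤ j) : m ^ j ≤ m ^ i := by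
    rw [← Nat.sub_add_cancel h, pow_add]
    exact mul_le_right' _ _
  refine ⟨fun a b => ?_, ⟨WellFounded.wellFounded_iff_has_min.2 fun S hS => ?_⟩⟩
  · rcases hcl a with rfl | ⟨i, rfl⟩
    · exact Or.inl bot_le
    rcases hcl b with rfl | ⟨j, rfl⟩
    · exact Or.inr bot_le
    exact (le_total j i).imp hanti hanti
  · classical
    -- The least exponent gives the largest power in `S`; without powers, `S` contains only `⊥`.
    by_cases h : ∃ k, m ^ k ∈ S
    · refine ⟨_, Nat.find_spec h, fun x hx => ?_⟩
      rcases hcl x with rfl | ⟨j, rfl⟩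
      · exact not_lt_bot
      · exact (hanti (Nat.find_min' h hx)).not_gt
    · obtain ⟨x, hx⟩ := hS
      refine ⟨x, hx, fun y hy => ?_⟩
      rcases hcl y with rfl | ⟨j, rfl⟩
      · exact not_lt_bot
      · exact absurd ⟨j, hy⟩ h

theorem isUFDLattice_or_isSpecialPrincipalElementLattice (hg : IsPrincipallyGenerated Q)
    (hmc : IsCoatom m) (hm : IsPrincipal m) (hloc : ∀ x : Q, x ≠ 1 → x ≤ m)
    (hP : ∀ p : Q, IsPrimeElement p → IsPrincipal p) :
    IsUFDLattice Q ∨ IsSpecialPrincipalElementLattice Q := by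
  have hm1 : m ≠ 1 := (isCoatom_iff_one.1 hmc).1
  have hcl := eq_bot_or_eq_pow hm hloc hm1 hP
  by_cases hne : ∃ k, m ^ k = ⊥
  · right
    obtain ⟨k, hk⟩ := hne
    have hcl' (x : Q) : ∃ j, x = m ^ j := (hcl x).elim (fun h => ⟨k, h.trans hk.symm⟩) id
    constructor
    · intro x
      obtain ⟨j, rfl⟩ := hcl' x
      exact hm.pow j
    · refine ⟨m, hmc, fun n hn => ?_, fun x => ?_⟩
      · exact ((hn.le_iff.1 (hloc n (isCoatom_iff_one.1 hn).1)).resolve_left hmc.1).symm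
      · obtain ⟨j, rfl⟩ := hcl' x
        exact ⟨{j}, by simp⟩
  · left
    push Not at hne
    have hbot : IsPrimeElement (⊥ : Q) :=
      iInf_pow_eq_bot hm hloc hm1 hP ▸ isPrimeElement_iInf_pow hm hloc hm1 hne
    refine ⟨hg, hbot, fun x _ => ?_⟩
    rcases hcl x with rfl | ⟨k, rfl⟩
    -- `⊥` is itself a principal prime, so it is its own factorization.
    · exact ⟨{⊥}, by simpa using ⟨isPrincipal_bot, hbot⟩, by simp⟩
    · refine ⟨Multiset.replicate k m, fun p hp => ?_, by simp⟩
      rw [Multiset.eq_of_mem_replicate hp]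
      exact ⟨hm, isPrimeElement_of_isCoatom hmc⟩

end Local

/-! ### Classification and converses -/

theorem classification_of_primes [Nontrivial Q] (hQ : IsWeakRLattice Q)
    (h : ∀ p : Q, IsPrimeElement p → p ≠ ⊥ → IsCompletelyStronglyHollow p) :
    IsBooleanAlgebraB4 Q ∨ (IsWeakNoetherLattice Q ∧ IsChainLattice Q ∧
      (IsUFDLattice Q ∨ IsSpecialPrincipalElementLattice Q)) := by
  have hg := hQ.principally_generated
  have hP (p : Q) (hp : IsPrimeElement p) : IsPrincipal p := by
    by_cases h0 : p = ⊥
    · exact h0 ▸ isPrincipal_bot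
    · exact (h p hp h0).isPrincipal hg
  have : IsCoatomic Q := CompleteLattice.coatomic_of_top_compact
    (IsMultiplicativeLattice.one_eq_top (Q := Q) ▸ hQ.cLattice.one_compact)
  obtain ⟨m, hm, -⟩ := (eq_top_or_exists_le_coatom (⊥ : Q)).resolve_left bot_ne_top
  by_cases hu : ∀ n : Q, IsCoatom n → n = m
  · right
    have hloc (x : Q) (hx : x ≠ 1) : x ≤ m := by
      rw [IsMultiplicativeLattice.one_eq_top] at hx
      obtain ⟨n, hn, hxn⟩ := (eq_top_or_exists_le_coatom x).resolve_left hx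
      exact hu n hn ▸ hxn
    have hmp := hP m (isPrimeElement_of_isCoatom hm)
    obtain ⟨hc, hw⟩ := chain_of_powers
      (eq_bot_or_eq_pow hmp hloc (isCoatom_iff_one.1 hm).1 hP)
    exact ⟨⟨hQ, hw⟩, hc, isUFDLattice_or_isSpecialPrincipalElementLattice hg hm hmp hloc hP⟩
  · left
    push Not at hu
    obtain ⟨n, hn, hne⟩ := hu
    have hcsh {p q : Q} (hp : IsCoatom p) (hq : IsCoatom q) (hpq : p ≠ q) :
        IsCompletelyStronglyHollow p :=
      -- If `p = ⊥`, then `p ≤ q`, and maximality would give `p = q`.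
      h p (isPrimeElement_of_isCoatom hp) fun h0 =>
        hpq ((hp.le_iff.1 (h0.le.trans bot_le)).resolve_left hq.1).symm
    exact isBooleanAlgebraB4_of_two_coatoms hg hm hn hne.symm (hcsh hm hn hne.symm)
      (hcsh hn hm hne)

theorem IsBooleanAlgebraB4.isCompletelyStronglyHollow (h : IsBooleanAlgebraB4 Q) {a : Q}
    (h0 : a ≠ ⊥) (h1 : a ≠ 1) : IsCompletelyStronglyHollow a := by
  obtain ⟨e, -⟩ := h
  -- An element not above an atom `c` lies below `cᶜ`, and so does any join of such elements.
  have key : ∀ c d : Bool × Bool, c ≠ ⊥ → c ≠ ⊤ → ¬ c ≤ d → d ≤ cᶜ := by decide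
  have key' : ∀ c : Bool × Bool, c ≠ ⊥ → ¬ c ≤ cᶜ := by decide
  have he0 : e a ≠ ⊥ := by simpa using h0
  have he1 : e a ≠ ⊤ := by simpa [IsMultiplicativeLattice.one_eq_top] using h1
  intro S _ ha
  by_contra! hc
  refine key' _ he0 (e.le_symm_apply.1 (ha.trans (sSup_le fun i hi => e.le_symm_apply.2 ?_)))
  exact key _ _ he0 he1 fun hle => hc i hi (e.le_iff_le.1 hle)

theorem IsBooleanAlgebraB4.not_isCompletelyStronglyHollow_one (h : IsBooleanAlgebraB4 Q) :
    ¬ IsCompletelyStronglyHollow (1 : Q) := by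
  obtain ⟨e, -⟩ := h
  intro h1
  have hsup : (1 : Q) ≤ e.symm (true, false) ⊔ e.symm (false, true) := by
    rw [← e.symm.map_sup, e.le_symm_apply]
    exact le_top
  have htop : e 1 = ⊤ := by rw [IsMultiplicativeLattice.one_eq_top, e.map_top]
  rcases h1.le_or_le hsup with h | h <;> rw [e.le_symm_apply, htop] at h <;>
    exact absurd h (by decide)

/-- Some factor lies below the prime, and every factor lies above the product. -/
theorem IsCompletelyStronglyHollow.of_isPrimeElement_of_prod_eq {p : Q} (hp : IsPrimeElement p)
    {s : Multiset Q} (hs : ∀ b ∈ s, IsCompletelyStronglyHollow b) (h : s.prod = p) :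
    IsCompletelyStronglyHollow p := by
  obtain ⟨b, hb, hbp⟩ := hp.exists_mem_le h.le
  exact le_antisymm hbp (h ▸ prod_le_of_mem hb) ▸ hs b hb

end MultLattice

open MultLattice

theorem mainTheorem2 (Q : Type*) [CommMonoid Q] [CompleteLattice Q] [IsMultiplicativeLattice Q]
    [Nontrivial Q] (hQ : MultLattice.IsWeakRLattice Q) :
    [ ∀ p : Q, MultLattice.IsPrimeElement p → p ≠ ⊥ → MultLattice.IsCompletelyStronglyHollow p,
      MultLattice.IsBooleanAlgebraB4 Q ∨
        (MultLattice.IsWeakNoetherLattice Q ∧ MultLattice.IsChainLattice Q ∧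
          (MultLattice.IsUFDLattice Q ∨ MultLattice.IsSpecialPrincipalElementLattice Q)),
      ∀ a : Q, a ≠ ⊥ → a ≠ 1 → MultLattice.IsCompletelyStronglyHollow a,
      ∀ a : Q, a ≠ ⊥ → a ≠ 1 → ∃ s : Multiset Q,
        (∀ b ∈ s, MultLattice.IsCompletelyStronglyHollow b) ∧ s.prod = a ].TFAE ∧
    [ ∀ a : Q, a ≠ ⊥ → MultLattice.IsCompletelyStronglyHollow a,
      ∀ a : Q, a ≠ ⊥ → ∃ s : Multiset Q, s ≠ 0 ∧
        (∀ b ∈ s, MultLattice.IsCompletelyStronglyHollow b) ∧ s.prod = a,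
      MultLattice.IsWeakNoetherLattice Q ∧ MultLattice.IsChainLattice Q ∧
        (MultLattice.IsUFDLattice Q ∨ MultLattice.IsSpecialPrincipalElementLattice Q) ].TFAE := by
  have factor_self {P : Q → Prop} (h : ∀ a, P a → IsCompletelyStronglyHollow a) (a : Q) (ha : P a) :
      ∃ s : Multiset Q, s ≠ 0 ∧ (∀ b ∈ s, IsCompletelyStronglyHollow b) ∧ s.prod = a :=
    ⟨{a}, by simp, by simpa using h a ha, by simp⟩
  have hchain (h : IsWeakNoetherLattice Q ∧ IsChainLattice Q ∧
      (IsUFDLattice Q ∨ IsSpecialPrincipalElementLattice Q)) (a : Q) :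
      IsCompletelyStronglyHollow a :=
    have := h.1.acc
    h.2.1.isCompletelyStronglyHollow a
  have of_factors (h : ∀ a : Q, a ≠ ⊥ → a ≠ 1 → ∃ s : Multiset Q,
      (∀ b ∈ s, IsCompletelyStronglyHollow b) ∧ s.prod = a) (p : Q) (hp : IsPrimeElement p)
      (h0 : p ≠ ⊥) : IsCompletelyStronglyHollow p := by
    obtain ⟨s, hs, hsp⟩ := h p h0 hp.lt_one.ne
    exact .of_isPrimeElement_of_prod_eq hp hs hsp
  have h10 : (1 : Q) ≠ ⊥ := IsMultiplicativeLattice.one_eq_top (Q := Q) ▸ top_ne_bot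
  constructor
  · tfae_have 1 → 2 := classification_of_primes hQ
    tfae_have 2 → 3 := by
      rintro (h | h) a h0 h1
      · exact h.isCompletelyStronglyHollow h0 h1
      · exact hchain h a
    tfae_have 3 → 4 := fun h a h0 h1 =>
      let ⟨s, _, hs⟩ := factor_self (P := fun a => a ≠ ⊥ ∧ a ≠ 1) (fun a ha => h a ha.1 ha.2) a ⟨h0, h1⟩
      ⟨s, hs⟩
    tfae_have 4 → 1 := of_factors
    tfae_finish
  · tfae_have 1 → 2 := factor_self
    tfae_have 2 → 3 := by
      intro h
      refine (classification_of_primes hQ (of_factors fun a h0 _ => ?_)).resolve_left fun hB => ?_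
      · obtain ⟨s, -, hs⟩ := h a h0
        exact ⟨s, hs⟩
      -- Factors of `1` equal `1`; nonemptiness of `s` provides one, so `1` would be hollow.
      · obtain ⟨s, hs0, hs, hs1⟩ := h 1 h10
        obtain ⟨b, hb⟩ := Multiset.exists_mem_of_ne_zero hs0
        have hb1 : b = 1 := le_antisymm (le_one' b) (hs1 ▸ prod_le_of_mem hb)
        exact hB.not_isCompletelyStronglyHollow_one (hb1 ▸ hs b hb)
    tfae_have 3 → 1 := fun h a _ => hchain h a
    tfae_finish
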